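/- Let $E$ be a Dedekind complete real vector lattice, let $X$ be a real vector lattice, and let $p:X\to E$ be an $E$-valued lattice norm, i.e. $p(x)\ge 0$; $p(x)=0$ iff $x=0$; $p(\lambda x)=|\lambda|p(x)$ for $\lambda\in\mathbb R$; $p(x+y)\le p(x)+p(y)$; and $|x|\le|y|$ implies $p(x)\le p(y)$. (So $(X,p,E)$ is a lattice-normed vector lattice.) A net $(x_\alpha)$ in a vector lattice $Y$ is order convergent to $0$ if there are nets $y_\beta\downarrow 0$ and $z_\gamma\downarrow 0$ in $Y$ such that for all $\beta,\gamma$ there is $\alpha_{\beta,\gamma}$ with $-y_\beta\le x_\alpha\le z_\gamma$ for all $\alpha\ge\alpha_{\beta,\gamma}$. The space $(X,p,E)$ is called $op$-continuous if, for every net $(x_\alpha)$ in $X$ that is order convergent to $0$ in $X$, the net $(p(x_\alpha))$ is order convergent to $0$ in $E$. Let ${}^*:V(S)\to V({}^*S)$ be a polysaturated nonstandard extension of a superstructure $V(S)$ that contains $X$ and $E$ as elements: ${}^*$ maps $S$ to ${}^*S$, satisfies the transfer principle for bounded formulas, and every family of fewer than $|V(S)|$ internal sets with the finite intersection property has nonempty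 intersection. For a vector lattice $Y\in V(S)$ put $$\eta({}^*Y)=\{\kappa\in{}^*Y:\ \inf\nolimits_Y\{y\in Y: -y\le\kappa\le y\}=0\}$$ (the infimum, taken in $Y$, is required to exist; $y\in Y$ is identified with ${}^*y$), and put $$\mathbf n({}^*X)=\{\kappa\in{}^*X:\ {}^*p(\kappa)\in\eta({}^*E)\}.$$ Then $(X,p,E)$ is $op$-continuous if and only if $\eta({}^*X)\subseteq\mathbf n({}^*X)$. -/

import Mathlib

universe u

namespace LatticeNormed

/-! ## Superstructures over a set of urelements -/

/-- The levels of the superstructure: `V₀(S) = S` and `Vₙ₊₁(S) = Vₙ(S) ∪ 𝒫(Vₙ(S))`. -/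
noncomputable def level (S : ZFSet.{u}) : ℕ → ZFSet.{u}
  | 0 => S
  | n + 1 => level S n ∪ ZFSet.powerset (level S n)

/-- A base set: a set whose elements behave as urelements for the superstructure above it, that is,
they are nonempty and have no element in common with the superstructure. -/
structure BaseSet : Type (u + 1) where
  carrier : ZFSet.{u}
  ne_empty : ∀ a ∈ carrier, a ≠ ∅
  disjoint : ∀ a ∈ carrier, ∀ n, ∀ x ∈ level carrier n, x ∉ a

/-- The superstructure `V(S) = ⋃ₙ Vₙ(S)`. -/
def Superstructure (S : BaseSet.{u}) : Type (u + 1) :=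
  {x : ZFSet.{u} // ∃ n, x ∈ level S.carrier n}

namespace Superstructure

variable {S : BaseSet.{u}}

/-- Membership in the superstructure. Elements of the base set have no elements here. -/
instance : Membership (Superstructure S) (Superstructure S) :=
  ⟨fun b a => a.1 ∈ b.1⟩

theorem mem_def {a b : Superstructure S} : a ∈ b ↔ a.1 ∈ b.1 := Iff.rfl

theorem level_mono (T : ZFSet.{u}) : Monotone fun n => (level T n : Set ZFSet.{u}) := by
  refine monotone_nat_of_le_succ fun n x hx => ?_
  have hx' : x ∈ level T n := hx
  show x ∈ level T (n + 1)
  simp [level, hx']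

theorem level_le (T : ZFSet.{u}) {m n : ℕ} (h : m ≤ n) {x : ZFSet.{u}} (hx : x ∈ level T m) :
    x ∈ level T n :=
  level_mono T h hx

theorem mem_level_of_mem (S : BaseSet.{u}) {n : ℕ} {a x : ZFSet.{u}} (ha : a ∈ level S.carrier n)
    (hx : x ∈ a) (hxV : ∃ m, x ∈ level S.carrier m) : x ∈ level S.carrier n := by
  induction n with
  | zero =>
    obtain ⟨m, hm⟩ := hxV
    exact absurd hx (S.disjoint a ha m x hm)
  | succ n ih =>
    rcases ZFSet.mem_union.1 ha with h | h
    · exact level_le _ n.le_succ (ih h)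
    · exact level_le _ n.le_succ (ZFSet.mem_powerset.1 h hx)

theorem mem_level_succ {T : ZFSet.{u}} {n : ℕ} {a : ZFSet.{u}} (h : ∀ x ∈ a, x ∈ level T n) :
    a ∈ level T (n + 1) :=
  ZFSet.mem_union.2 (Or.inr (ZFSet.mem_powerset.2 fun _ hx => h _ hx))

theorem pair_mem_level {T : ZFSet.{u}} {n : ℕ} {a b : ZFSet.{u}} (ha : a ∈ level T n)
    (hb : b ∈ level T n) : ZFSet.pair a b ∈ level T (n + 2) := by
  refine mem_level_succ fun x hx => mem_level_succ fun y hy => ?_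
  rcases ZFSet.mem_pair.1 hx with rfl | rfl
  · rw [ZFSet.mem_singleton.1 hy]; exact ha
  · rcases ZFSet.mem_pair.1 hy with rfl | rfl <;> assumption

/-- The base set as an element of the superstructure. -/
noncomputable def base (S : BaseSet.{u}) : Superstructure S :=
  ⟨S.carrier, 1, mem_level_succ fun _ hx => hx⟩

/-- The Kuratowski pair `(a, b) = {{a}, {a, b}}`. -/
noncomputable def pair (a b : Superstructure S) : Superstructure S :=
  ⟨ZFSet.pair a.1 b.1, by
    obtain ⟨m, hm⟩ := a.2
    obtain ⟨n, hn⟩ := b.2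
    exact ⟨max m n + 2, pair_mem_level (level_le _ (le_max_left m n) hm)
      (level_le _ (le_max_right m n) hn)⟩⟩

/-- The subset of `A × B` cut out by the relation `r`, as an element of the superstructure. -/
noncomputable def relation (A B : Superstructure S)
    (r : Superstructure S → Superstructure S → Prop) : Superstructure S :=
  ⟨(ZFSet.prod A.1 B.1).sep fun z => ∃ a b : Superstructure S,
      a ∈ A ∧ b ∈ B ∧ r a b ∧ z = (pair a b).1, by
    obtain ⟨m, hm⟩ := A.2
    obtain ⟨n, hn⟩ := B.2
    refine ⟨max m n + 3, mem_level_succ fun z hz => ?_⟩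
    obtain ⟨a, b, ha, hb, -, rfl⟩ := (ZFSet.mem_sep.1 hz).2
    exact pair_mem_level
      (level_le _ (le_max_left m n) (mem_level_of_mem S hm ha a.2))
      (level_le _ (le_max_right m n) (mem_level_of_mem S hn hb b.2))⟩

theorem mem_relation {A B : Superstructure S} {r : Superstructure S → Superstructure S → Prop}
    {z : Superstructure S} :
    z ∈ relation A B r ↔ ∃ a b, a ∈ A ∧ b ∈ B ∧ r a b ∧ z = pair a b := by
  rw [mem_def, relation, ZFSet.mem_sep]
  constructor
  · rintro ⟨-, a, b, ha, hb, hr, h⟩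
    exact ⟨a, b, ha, hb, hr, Subtype.ext h⟩
  · rintro ⟨a, b, ha, hb, hr, rfl⟩
    exact ⟨ZFSet.pair_mem_prod.2 ⟨ha, hb⟩, a, b, ha, hb, hr, rfl⟩

end Superstructure

/-! ## Bounded formulas and nonstandard enlargements -/

/-- Bounded formulas of the language of set theory, with variables indexed by `ℕ`. The remaining
connectives and the bounded existential quantifier are the usual abbreviations. -/
inductive SetFormula : Type
  /-- `xᵢ = xⱼ` -/
  | eq (i j : ℕ) : SetFormula
  /-- `xᵢ ∈ xⱼ` -/
  | mem (i j : ℕ) : SetFormula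
  /-- `¬ φ` -/
  | not (φ : SetFormula) : SetFormula
  /-- `φ ∧ ψ` -/
  | and (φ ψ : SetFormula) : SetFormula
  /-- `∀ xᵢ ∈ xⱼ, φ` -/
  | ball (i j : ℕ) (φ : SetFormula) : SetFormula

/-- Satisfaction of a bounded formula in a superstructure under an assignment of the variables. -/
def SetFormula.Holds {S : BaseSet.{u}} : SetFormula → (ℕ → Superstructure S) → Prop
  | .eq i j, v => v i = v j
  | .mem i j, v => v i ∈ v j
  | .not φ, v => ¬ φ.Holds v
  | .and φ ψ, v => φ.Holds v ∧ ψ.Holds v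
  | .ball i j φ, v => ∀ a, a ∈ v j → φ.Holds (Function.update v i a)

/-- A nonstandard extension `* : V(S) → V(*S)`: a map that sends `S` to `*S` and satisfies the
transfer principle for all bounded formulas with parameters. -/
structure NonstandardExtension (S S' : BaseSet.{u}) where
  /-- The map `a ↦ *a`. -/
  map : Superstructure S → Superstructure S'
  map_base : map (Superstructure.base S) = Superstructure.base S'
  transfer : ∀ (φ : SetFormula) (v : ℕ → Superstructure S),
    φ.Holds v ↔ φ.Holds fun i => map (v i)

/-- A copy of the type `X` as a set in the superstructure, that is, an identification of `X` with
the set of all elements of some `A ∈ V(S)`. -/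
structure Copy (S : BaseSet.{u}) (X : Type u) where
  /-- The set `A`. -/
  set : Superstructure S
  /-- The identification of `X` with `A`. -/
  equiv : X ≃ {a : Superstructure S // a ∈ set}

namespace NonstandardExtension

variable {S S' : BaseSet.{u}} (N : NonstandardExtension S S')

/-- An internal set: an element of some `*a`, `a ∈ V(S)`, that is not an urelement. -/
def IsInternalSet (b : Superstructure S') : Prop :=
  b ∉ Superstructure.base S' ∧ ∃ a, b ∈ N.map a

/-- The general saturation principle: every family of fewer than `|V(S)|` internal sets that has
the finite intersection property has nonempty intersection. -/
def IsPolysaturated : Prop :=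
  ∀ F : Set (Superstructure S'), (∀ b ∈ F, N.IsInternalSet b) →
    Cardinal.mk F < Cardinal.mk (Superstructure S) →
    (∀ G : Set (Superstructure S'), G ⊆ F → G.Finite → ∃ x, ∀ b ∈ G, x ∈ b) →
    ∃ x, ∀ b ∈ F, x ∈ b

variable {X Y : Type u}

/-- The nonstandard extension `*X` of a standard set `X`. -/
def starSet (P : Copy S X) : Set (Superstructure S') :=
  {κ | κ ∈ N.map P.set}

/-- The canonical embedding `x ↦ *x` of `X` into `*X`. -/
def coe (P : Copy S X) (x : X) : Superstructure S' :=
  N.map (P.equiv x).1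

/-- The nonstandard extension `*r` of a standard relation `r ⊆ X × Y`. For the graph of a function
`f : X → Y` this is the graph of `*f : *X → *Y`. -/
def starRel (P : Copy S X) (Q : Copy S Y) (r : X → Y → Prop) (κ ξ : Superstructure S') : Prop :=
  Superstructure.pair κ ξ ∈ N.map (Superstructure.relation P.set Q.set
    fun a b => ∃ x y, r x y ∧ a = (P.equiv x).1 ∧ b = (Q.equiv y).1)

/-- `η(*Y) = {κ ∈ *Y : inf {y ∈ Y : -y ≤ κ ≤ y} = 0}`; the infimum is required to exist in `Y`. -/
def eta [AddCommGroup Y] [Lattice Y] (Q : Copy S Y) : Set (Superstructure S') :=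
  {κ | κ ∈ N.starSet Q ∧
    IsGLB {y : Y | N.starRel Q Q (· ≤ ·) (N.coe Q (-y)) κ ∧
      N.starRel Q Q (· ≤ ·) κ (N.coe Q y)} 0}

/-- `n(*X) = {κ ∈ *X : *p(κ) ∈ η(*E)}`, for `p : X → E`. -/
def infinitesimals {E : Type u} [AddCommGroup E] [Lattice E] (P : Copy S X) (Q : Copy S E)
    (p : X → E) : Set (Superstructure S') :=
  {κ | κ ∈ N.starSet P ∧ ∃ ξ, N.starRel P Q (fun x e => p x = e) κ ξ ∧ ξ ∈ N.eta Q}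

end NonstandardExtension

/-! ## Lattice-normed vector lattices and order convergence -/

/-- Dedekind completeness: every nonempty set that is bounded above has a supremum. -/
def DedekindComplete (E : Type u) [Lattice E] : Prop :=
  ∀ s : Set E, s.Nonempty → BddAbove s → ∃ a, IsLUB s a

/-- `p : X → E` is an `E`-valued lattice norm on the vector lattice `X`, i.e. `(X, p, E)` is a
lattice-normed vector lattice. -/
structure IsLatticeNorm {X E : Type u} [AddCommGroup X] [Lattice X] [Module ℝ X]
    [AddCommGroup E] [Lattice E] [Module ℝ E] (p : X → E) : Prop where
  nonneg : ∀ x, 0 ≤ p x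
  eq_zero_iff : ∀ x, p x = 0 ↔ x = 0
  smul : ∀ (c : ℝ) (x : X), p (c • x) = |c| • p x
  add_le : ∀ x y, p (x + y) ≤ p x + p y
  mono : ∀ x y, |x| ≤ |y| → p x ≤ p y

/-- `y_β ↓ 0`: the net is decreasing and has infimum `0`. -/
def DecreasesToZero {B Y : Type u} [Preorder B] [AddCommGroup Y] [Lattice Y] (y : B → Y) : Prop :=
  Antitone y ∧ IsGLB (Set.range y) 0

/-- Order convergence to zero of a net: there are nets `y_β ↓ 0` and `z_γ ↓ 0`, possibly with other
index sets, such that for all `β`, `γ` eventually `-y_β ≤ x_α ≤ z_γ`. -/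
def OrderNull {A Y : Type u} [Preorder A] [AddCommGroup Y] [Lattice Y] (x : A → Y) : Prop :=
  ∃ (B C : Type u) (_ : Preorder B) (_ : Preorder C) (y : B → Y) (z : C → Y),
    IsDirectedOrder B ∧ Nonempty B ∧ IsDirectedOrder C ∧ Nonempty C ∧
    DecreasesToZero y ∧ DecreasesToZero z ∧
    ∀ (b : B) (c : C), ∃ a₀ : A, ∀ a, a₀ ≤ a → -y b ≤ x a ∧ x a ≤ z c

/-- `p`-convergence of a net: `p (x_α - l)` order converges to `0` in `E`. -/
def PTendsto {A X E : Type u} [Preorder A] [AddCommGroup X] [AddCommGroup E] [Lattice E]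
    (p : X → E) (x : A → X) (l : X) : Prop :=
  OrderNull fun a => p (x a - l)

/-- `op`-continuity: every net that order converges to `0` also `p`-converges to `0`. -/
def OpContinuous {X E : Type u} [AddCommGroup X] [Lattice X] [AddCommGroup E] [Lattice E]
    (p : X → E) : Prop :=
  ∀ (A : Type u) [Preorder A] [IsDirectedOrder A] [Nonempty A] (x : A → X),
    OrderNull x → PTendsto p x 0

end LatticeNormed

/-! The set `U` of standard `y` with `-y ≤ κ ≤ y` is closed under infima, so for `κ ∈ η(*X)` it is
itself a net decreasing to `0`. Under op-continuity `p` carries it to an order null net, and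
transfer puts `p(U)` among the bounds of `*p(κ)`; hence those bounds have infimum `0`
(`OpContinuous.eta_subset`).

Conversely, let a null net be controlled by `y_β ↓ 0` and `z_γ ↓ 0`, and let `W` be the set of sums
`y_β + z_γ`. Saturation gives `κ ∈ *W` below every element of `W` (`IsPolysaturated.exists_le`), so
`κ ∈ η(*X)` and `*p(κ) ∈ η(*E)`. A lower bound of `p(W)` lies below `*p(κ)` by transfer, hence below
all its standard bounds, hence below `0`. So `p(y_β + z_γ) ↓ 0`, and this net dominates `p(x_α)`
(`opContinuous_of_eta_subset`). -/

namespace LatticeNormed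

/-! ### Extensionality, pairs and separation in the superstructure -/

namespace Superstructure

variable {S : BaseSet.{u}}

/-- An urelement may have `ZFSet` elements outside the superstructure. One element inside excludes
this case and places `a` in a power set stage. -/
theorem exists_level_of_mem {a x : Superstructure S} (hx : x ∈ a) {z : ZFSet.{u}} (hz : z ∈ a.1) :
    ∃ n, z ∈ level S.carrier n := by
  obtain ⟨n, hn⟩ := a.2
  induction n with
  | zero =>
    obtain ⟨m, hm⟩ := x.2
    exact absurd hx (S.disjoint a.1 hn m x.1 hm)
  | succ n ih =>
    rcases ZFSet.mem_union.1 hn with h | h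
    · exact ih h
    · exact ⟨n, ZFSet.mem_powerset.1 h hz⟩

/-- Extensionality, for an object of the superstructure that is not an urelement. -/
theorem ext_of_mem {a b x : Superstructure S} (hx : x ∈ a) (h : ∀ z, z ∈ a ↔ z ∈ b) : a = b := by
  have hb : x ∈ b := (h x).1 hx
  refine Subtype.ext (ZFSet.ext fun z => ⟨fun hz => ?_, fun hz => ?_⟩)
  · exact (h ⟨z, exists_level_of_mem hx hz⟩).1 hz
  · exact (h ⟨z, exists_level_of_mem hb hz⟩).2 hz

theorem not_mem_base_of_mem {a x : Superstructure S} (hx : x ∈ a) : a ∉ base S := by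
  obtain ⟨m, hm⟩ := x.2
  exact fun ha => S.disjoint a.1 ha m x.1 hm hx

/-- The unordered pair `{a, b}`. -/
noncomputable def unordered (a b : Superstructure S) : Superstructure S :=
  ⟨{a.1, b.1}, by
    obtain ⟨m, hm⟩ := a.2
    obtain ⟨n, hn⟩ := b.2
    refine ⟨max m n + 1, mem_level_succ fun x hx => ?_⟩
    rcases ZFSet.mem_pair.1 hx with rfl | rfl
    · exact level_le _ (le_max_left m n) hm
    · exact level_le _ (le_max_right m n) hn⟩

theorem mem_unordered {a b x : Superstructure S} : x ∈ unordered a b ↔ x = a ∨ x = b := by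
  exact ZFSet.mem_pair.trans (or_congr Subtype.ext_iff.symm Subtype.ext_iff.symm)

theorem pair_eq (a b : Superstructure S) :
    pair a b = unordered (unordered a a) (unordered a b) := by
  apply Subtype.ext
  have : ({a.1, a.1} : ZFSet.{u}) = {a.1} := by
    ext z; simp
  simp only [pair, unordered, ZFSet.pair, this]

theorem eq_unordered_iff {a b c : Superstructure S} :
    c = unordered a b ↔ a ∈ c ∧ b ∈ c ∧ ∀ t, t ∈ c → t = a ∨ t = b := by
  constructor
  · rintro rfl
    simp [mem_unordered]
  · rintro ⟨ha, hb, h⟩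
    refine ext_of_mem ha fun z => ⟨fun hz => mem_unordered.2 (h z hz), fun hz => ?_⟩
    rcases mem_unordered.1 hz with rfl | rfl <;> assumption

theorem pair_inj {a b c d : Superstructure S} : pair a b = pair c d ↔ a = c ∧ b = d := by
  exact Subtype.ext_iff.trans
    (ZFSet.pair_inj.trans (and_congr Subtype.ext_iff.symm Subtype.ext_iff.symm))

theorem pair_mem_relation {A B a b : Superstructure S}
    {r : Superstructure S → Superstructure S → Prop} :
    pair a b ∈ relation A B r ↔ a ∈ A ∧ b ∈ B ∧ r a b := by
  rw [mem_relation]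
  constructor
  · rintro ⟨a', b', ha, hb, hr, h⟩
    obtain ⟨rfl, rfl⟩ := pair_inj.1 h
    exact ⟨ha, hb, hr⟩
  · rintro ⟨ha, hb, hr⟩
    exact ⟨a, b, ha, hb, hr, rfl⟩

/-- The subset of `A` cut out by the predicate `q`, as an element of the superstructure. -/
noncomputable def sep (A : Superstructure S) (q : Superstructure S → Prop) : Superstructure S :=
  ⟨A.1.sep fun z => ∃ a : Superstructure S, q a ∧ z = a.1, by
    obtain ⟨m, hm⟩ := A.2
    refine ⟨m + 1, mem_level_succ fun z hz => ?_⟩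
    obtain ⟨hzA, a, -, rfl⟩ := ZFSet.mem_sep.1 hz
    exact mem_level_of_mem S hm hzA a.2⟩

theorem mem_sep {A : Superstructure S} {q : Superstructure S → Prop} {a : Superstructure S} :
    a ∈ sep A q ↔ a ∈ A ∧ q a := by
  rw [mem_def, sep, ZFSet.mem_sep]
  refine and_congr Iff.rfl ⟨?_, fun h => ⟨a, h, rfl⟩⟩
  rintro ⟨b, hb, h⟩
  rwa [Subtype.ext h]

end Superstructure

/-! ### Bounded formulas for ordered pairs -/

namespace SetFormula

open Superstructure

variable {S : BaseSet.{u}}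

/-- `φ → ψ` -/
def imp (φ ψ : SetFormula) : SetFormula := .not (.and φ (.not ψ))

/-- `φ ∨ ψ` -/
def or (φ ψ : SetFormula) : SetFormula := .not (.and (.not φ) (.not ψ))

/-- `∃ xᵢ ∈ xⱼ, φ` -/
def bex (i j : ℕ) (φ : SetFormula) : SetFormula := .not (.ball i j (.not φ))

@[simp] theorem holds_eq {i j : ℕ} {v : ℕ → Superstructure S} :
    (SetFormula.eq i j).Holds v ↔ v i = v j := Iff.rfl

@[simp] theorem holds_mem {i j : ℕ} {v : ℕ → Superstructure S} :
    (SetFormula.mem i j).Holds v ↔ v i ∈ v j := Iff.rfl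

@[simp] theorem holds_not {φ : SetFormula} {v : ℕ → Superstructure S} :
    (SetFormula.not φ).Holds v ↔ ¬ φ.Holds v := Iff.rfl

@[simp] theorem holds_and {φ ψ : SetFormula} {v : ℕ → Superstructure S} :
    (SetFormula.and φ ψ).Holds v ↔ φ.Holds v ∧ ψ.Holds v := Iff.rfl

@[simp] theorem holds_ball {i j : ℕ} {φ : SetFormula} {v : ℕ → Superstructure S} :
    (SetFormula.ball i j φ).Holds v ↔ ∀ a, a ∈ v j → φ.Holds (Function.update v i a) := Iff.rfl

@[simp] theorem holds_imp {φ ψ : SetFormula} {v : ℕ → Superstructure S} :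
    (imp φ ψ).Holds v ↔ (φ.Holds v → ψ.Holds v) := by
  simp [imp]

@[simp] theorem holds_or {φ ψ : SetFormula} {v : ℕ → Superstructure S} :
    (or φ ψ).Holds v ↔ φ.Holds v ∨ ψ.Holds v := by
  simp only [or, holds_not, holds_and]; tauto

@[simp] theorem holds_bex {i j : ℕ} {φ : SetFormula} {v : ℕ → Superstructure S} :
    (bex i j φ).Holds v ↔ ∃ a, a ∈ v j ∧ φ.Holds (Function.update v i a) := by
  simp [bex]

/-- `xₖ = {xᵢ, xⱼ}`, for `i, j, k ≠ 10` -/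
def isUnordered (k i j : ℕ) : SetFormula :=
  .and (.mem i k) (.and (.mem j k) (.ball 10 k (or (.eq 10 i) (.eq 10 j))))

theorem holds_isUnordered {k i j : ℕ} {v : ℕ → Superstructure S}
    (hi : i ≠ 10) (hj : j ≠ 10) :
    (isUnordered k i j).Holds v ↔ v k = unordered (v i) (v j) := by
  simp [isUnordered, eq_unordered_iff, hi, hj]

/-- `(xᵢ, xⱼ) ∈ xₖ`, for `i, j < 10` -/
def pairMem (i j k : ℕ) : SetFormula :=
  -- Variable 13 is the pair; 11 and 12 are its elements `{xᵢ}` and `{xᵢ, xⱼ}`, so all quantifiers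
  -- are bounded. Variable 10 is reserved for `isUnordered`.
  bex 13 k (bex 11 13 (bex 12 13
    (.and (isUnordered 11 i i) (.and (isUnordered 12 i j) (isUnordered 13 11 12)))))

@[simp] theorem holds_pairMem {i j k : ℕ} {v : ℕ → Superstructure S} (hi : i < 10) (hj : j < 10) :
    (pairMem i j k).Holds v ↔ pair (v i) (v j) ∈ v k := by
  have h1 : i ≠ 10 := by omega
  have h2 : j ≠ 10 := by omega
  have h3 : i ≠ 11 := by omega
  have h4 : j ≠ 11 := by omega
  have h5 : i ≠ 12 := by omega
  have h6 : j ≠ 12 := by omega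
  have h7 : i ≠ 13 := by omega
  have h8 : j ≠ 13 := by omega
  simp only [pairMem, holds_bex, holds_and, holds_isUnordered h1 h1, holds_isUnordered h1 h2,
    holds_isUnordered (show 11 ≠ 10 by decide) (show 12 ≠ 10 by decide),
    Function.update_apply, h3, h4, h5, h6, h7, h8, if_true, if_false,
    show (11 : ℕ) ≠ 12 by decide, show (13 : ℕ) ≠ 12 by decide, show (13 : ℕ) ≠ 11 by decide]
  constructor
  · rintro ⟨z, hz, a, -, b, -, rfl, rfl, rfl⟩
    rwa [pair_eq]
  · intro h
    rw [pair_eq] at h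
    exact ⟨_, h, _, mem_unordered.2 (Or.inl rfl), _, mem_unordered.2 (Or.inr rfl), rfl, rfl, rfl⟩

end SetFormula

/-- The assignment `x₀ = a, x₁ = b, x₂ = c, x₃ = d` (and `xᵢ = d` for `i > 3`). -/
def assign {α : Type*} (a b c d : α) : ℕ → α
  | 0 => a
  | 1 => b
  | 2 => c
  | _ + 3 => d

@[simp] theorem assign_zero {α : Type*} (a b c d : α) : assign a b c d 0 = a := rfl
@[simp] theorem assign_one {α : Type*} (a b c d : α) : assign a b c d 1 = b := rfl
@[simp] theorem assign_two {α : Type*} (a b c d : α) : assign a b c d 2 = c := rfl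
@[simp] theorem assign_three {α : Type*} (a b c d : α) : assign a b c d 3 = d := rfl

/-! ### Transfer for subsets and relations -/

namespace NonstandardExtension

open Superstructure SetFormula

variable {S S' : BaseSet.{u}} (N : NonstandardExtension S S')

theorem transfer_assign (φ : SetFormula) (a b c d : Superstructure S) :
    φ.Holds (assign a b c d) ↔ φ.Holds (assign (N.map a) (N.map b) (N.map c) (N.map d)) := by
  rw [N.transfer]
  have : (fun i => N.map (assign a b c d i))
      = assign (N.map a) (N.map b) (N.map c) (N.map d) := by
    funext i
    rcases i with _ | _ | _ | i <;> rfl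
  rw [this]

theorem map_mem_map {a b : Superstructure S} : N.map a ∈ N.map b ↔ a ∈ b := by
  simpa using (N.transfer_assign (.mem 0 1) a b a a).symm

theorem map_inter_subset {a b c : Superstructure S} :
    (∀ x, x ∈ a → x ∈ b → x ∈ c) ↔ ∀ x, x ∈ N.map a → x ∈ N.map b → x ∈ N.map c := by
  simpa [Function.update_apply] using
    N.transfer_assign (.ball 4 0 (imp (.mem 4 1) (.mem 4 2))) a b c a

theorem map_section_right {a r c d : Superstructure S} :
    (∀ x, x ∈ a → (pair c x ∈ r ↔ x ∈ d)) ↔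
      ∀ x, x ∈ N.map a → (pair (N.map c) x ∈ N.map r ↔ x ∈ N.map d) := by
  simpa [Function.update_apply, ← iff_def] using
    N.transfer_assign (.ball 4 0 (.and (imp (pairMem 2 4 1) (.mem 4 3))
      (imp (.mem 4 3) (pairMem 2 4 1)))) a r c d

theorem map_section_left {a r c d : Superstructure S} :
    (∀ x, x ∈ a → (pair x c ∈ r ↔ x ∈ d)) ↔
      ∀ x, x ∈ N.map a → (pair x (N.map c) ∈ N.map r ↔ x ∈ N.map d) := by
  simpa [Function.update_apply, ← iff_def] using
    N.transfer_assign (.ball 4 0 (.and (imp (pairMem 4 2 1) (.mem 4 3))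
      (imp (.mem 4 3) (pairMem 4 2 1)))) a r c d

theorem map_total {a b r : Superstructure S} :
    (∀ x, x ∈ a → ∃ y, y ∈ b ∧ pair x y ∈ r) ↔
      ∀ x, x ∈ N.map a → ∃ y, y ∈ N.map b ∧ pair x y ∈ N.map r := by
  simpa [Function.update_apply] using
    N.transfer_assign (.ball 4 0 (bex 5 1 (pairMem 4 5 2))) a b r a

theorem map_image {a b r c : Superstructure S} :
    (∀ x, x ∈ a → ∀ y, y ∈ b → pair x y ∈ r → y ∈ c) ↔
      ∀ x, x ∈ N.map a → ∀ y, y ∈ N.map b → pair x y ∈ N.map r → y ∈ N.map c := by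
  simpa [Function.update_apply] using
    N.transfer_assign (.ball 4 0 (.ball 5 1 (imp (pairMem 4 5 2) (.mem 5 3)))) a b r c

variable {X Y : Type u}

/-- A subset of `X`, as an element of the superstructure. -/
noncomputable def toSet (P : Copy S X) (s : Set X) : Superstructure S :=
  sep P.set fun a => ∃ x ∈ s, a = (P.equiv x).1

theorem mem_toSet {P : Copy S X} {s : Set X} {a : Superstructure S} :
    a ∈ toSet P s ↔ ∃ x ∈ s, a = (P.equiv x).1 := by
  rw [toSet, mem_sep]
  refine and_iff_right_of_imp ?_
  rintro ⟨x, -, rfl⟩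
  exact (P.equiv x).2

theorem equiv_inj {P : Copy S X} {x y : X} : (P.equiv x).1 = (P.equiv y).1 ↔ x = y := by
  rw [← Subtype.ext_iff, P.equiv.apply_eq_iff_eq]

theorem equiv_mem_toSet {P : Copy S X} {s : Set X} {x : X} :
    (P.equiv x).1 ∈ toSet P s ↔ x ∈ s := by
  simp [mem_toSet, equiv_inj]

theorem toSet_injective (P : Copy S X) : Function.Injective (toSet P) := fun s t h => by
  ext x
  rw [← equiv_mem_toSet (P := P), h, equiv_mem_toSet]

theorem exists_equiv {P : Copy S X} {a : Superstructure S} (ha : a ∈ P.set) :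
    ∃ x, a = (P.equiv x).1 :=
  ⟨P.equiv.symm ⟨a, ha⟩, by simp⟩

/-- The nonstandard extension `*s` of a subset `s` of `X`. -/
noncomputable def star (P : Copy S X) (s : Set X) : Superstructure S' := N.map (toSet P s)

variable {N} {P : Copy S X} {Q : Copy S Y} {s t : Set X} {κ ξ : Superstructure S'}

theorem coe_mem_star {x : X} : N.coe P x ∈ N.star P s ↔ x ∈ s := by
  rw [coe, star, map_mem_map, equiv_mem_toSet]

theorem star_inter_subset {r : Set X} (h : s ∩ t ⊆ r) (h1 : κ ∈ N.star P s)
    (h2 : κ ∈ N.star P t) : κ ∈ N.star P r := by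
  refine N.map_inter_subset.1 (fun a ha ha' => ?_) κ h1 h2
  obtain ⟨x, hx, rfl⟩ := mem_toSet.1 ha
  exact equiv_mem_toSet.2 (h ⟨hx, equiv_mem_toSet.1 ha'⟩)

theorem star_mono (h : s ⊆ t) (h1 : κ ∈ N.star P s) : κ ∈ N.star P t :=
  star_inter_subset (Set.inter_subset_left.trans h) h1 h1

theorem mem_starSet_of_mem_star (h1 : κ ∈ N.star P s) : κ ∈ N.starSet P := by
  refine N.map_inter_subset.1 (fun a ha _ => ?_) κ h1 h1
  obtain ⟨x, hx, rfl⟩ := mem_toSet.1 ha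
  exact (P.equiv x).2

theorem mem_star_of_mem_starSet (hs : ∀ x, x ∈ s) (h1 : κ ∈ N.starSet P) : κ ∈ N.star P s := by
  refine N.map_inter_subset.1 (fun a ha _ => ?_) κ h1 h1
  obtain ⟨x, rfl⟩ := exists_equiv ha
  exact equiv_mem_toSet.2 (hs x)

/-- An extension `*s` that has an element comes from a nonempty set. -/
theorem nonempty_of_mem_star (h1 : κ ∈ N.star P s) : s.Nonempty := by
  by_contra h
  rw [Set.not_nonempty_iff_eq_empty] at h
  subst h
  -- The transferred sentence is `∀ x ∈ ∅, x ≠ x`.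
  have := (N.transfer_assign (.ball 4 0 (.not (.eq 4 4))) (toSet P ∅) (toSet P ∅) (toSet P ∅)
    (toSet P ∅)).1 (fun a ha => by simp [mem_toSet] at ha)
  exact this κ h1 rfl

theorem starRel_coe_left {r : X → Y → Prop} {x : X} (hξ : ξ ∈ N.starSet Q) :
    N.starRel P Q r (N.coe P x) ξ ↔ ξ ∈ N.star Q {y | r x y} := by
  refine N.map_section_right.1 (fun b hb => ?_) ξ hξ
  obtain ⟨y, rfl⟩ := exists_equiv hb
  simp [pair_mem_relation, equiv_mem_toSet, equiv_inj, (P.equiv x).2, (Q.equiv y).2]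

theorem starRel_coe_right {r : X → Y → Prop} {y : Y} (hκ : κ ∈ N.starSet P) :
    N.starRel P Q r κ (N.coe Q y) ↔ κ ∈ N.star P {x | r x y} := by
  refine N.map_section_left.1 (fun b hb => ?_) κ hκ
  obtain ⟨x, rfl⟩ := exists_equiv hb
  simp [pair_mem_relation, equiv_mem_toSet, equiv_inj, (P.equiv x).2, (Q.equiv y).2]

theorem exists_starRel {r : X → Y → Prop} (hr : ∀ x, ∃ y, r x y) (hκ : κ ∈ N.starSet P) :
    ∃ ξ, ξ ∈ N.starSet Q ∧ N.starRel P Q r κ ξ := by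
  refine N.map_total.1 (fun a ha => ?_) κ hκ
  obtain ⟨x, rfl⟩ := exists_equiv ha
  obtain ⟨y, hy⟩ := hr x
  exact ⟨_, (Q.equiv y).2, pair_mem_relation.2 ⟨ha, (Q.equiv y).2, x, y, hy, rfl, rfl⟩⟩

theorem mem_star_of_starRel {r : X → Y → Prop} {t : Set Y} (h : ∀ x ∈ s, ∀ y, r x y → y ∈ t)
    (hκ : κ ∈ N.star P s) (hξ : ξ ∈ N.starSet Q) (hr : N.starRel P Q r κ ξ) : ξ ∈ N.star Q t := by
  refine N.map_image.1 (fun a ha b hb hab => ?_) κ hκ ξ hξ hr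
  obtain ⟨x, hx, rfl⟩ := mem_toSet.1 ha
  obtain ⟨y, rfl⟩ := exists_equiv hb
  obtain ⟨-, -, x', y', hr', h1, h2⟩ := pair_mem_relation.1 hab
  rw [equiv_inj] at h1 h2
  subst h1 h2
  exact equiv_mem_toSet.2 (h x hx y hr')

/-! ### Standard bounds of a nonstandard element -/

section Eta

variable [AddCommGroup Y] [Lattice Y]

/-- The standard upper bounds of the absolute value of `κ`. -/
def bounds (N : NonstandardExtension S S') (Q : Copy S Y) (κ : Superstructure S') : Set Y :=
  {y | κ ∈ N.star Q (Set.Icc (-y) y)}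

theorem mem_eta_iff : κ ∈ N.eta Q ↔ κ ∈ N.starSet Q ∧ IsGLB (N.bounds Q κ) 0 := by
  refine and_congr_right fun hκ => ?_
  suffices h : {y : Y | N.starRel Q Q (· ≤ ·) (N.coe Q (-y)) κ ∧
      N.starRel Q Q (· ≤ ·) κ (N.coe Q y)} = N.bounds Q κ by rw [h]
  ext y
  rw [Set.mem_ofPred_eq, starRel_coe_left hκ, starRel_coe_right hκ]
  exact ⟨fun h => star_inter_subset (fun _ hx => hx) h.1 h.2,
    fun h => ⟨star_mono (fun _ hx => hx.1) h, star_mono (fun _ hx => hx.2) h⟩⟩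

/-- Since `*[-y, y]` contains `κ`, the standard interval `[-y, y]` is nonempty. Thus `0` is always a
lower bound of the bounds. -/
theorem nonneg_of_mem_bounds [IsOrderedAddMonoid Y] {y : Y} (hy : y ∈ N.bounds Q κ) : 0 ≤ y := by
  obtain ⟨x, h1, h2⟩ := nonempty_of_mem_star hy
  exact (abs_nonneg x).trans (abs_le'.2 ⟨h2, neg_le.1 h1⟩)

theorem inf_mem_bounds [IsOrderedAddMonoid Y] {y z : Y} (hy : y ∈ N.bounds Q κ)
    (hz : z ∈ N.bounds Q κ) : y ⊓ z ∈ N.bounds Q κ := by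
  refine star_inter_subset ?_ hy hz
  rintro x ⟨⟨h1, h2⟩, h3, h4⟩
  exact ⟨neg_le.1 (le_inf (neg_le.1 h1) (neg_le.1 h3)), le_inf h2 h4⟩

/-- If the empty set had infimum `0`, then `0` would be the greatest element of `Y`. The group would
be trivial, and `0` would be a bound after all. -/
theorem bounds_nonempty [IsOrderedAddMonoid Y] (hκ : κ ∈ N.eta Q) : (N.bounds Q κ).Nonempty := by
  obtain ⟨h1, h2⟩ := mem_eta_iff.1 hκ
  by_contra h
  rw [Set.not_nonempty_iff_eq_empty] at h
  have hle : ∀ y : Y, y ≤ 0 := fun y => h2.2 (by simp [h])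
  have h0 : (0 : Y) ∈ N.bounds Q κ :=
    mem_star_of_mem_starSet
      (fun x => ⟨neg_le.1 (by simpa using hle (-x)), hle x⟩) h1
  rw [h] at h0
  exact h0

end Eta

/-! ### Saturation -/

/-- All subsets of `X` embed in `V(S)`, so Cantor's theorem applies; this keeps families indexed by
subsets of `X` within reach of saturation. -/
theorem mk_lt_mk_superstructure (P : Copy S X) :
    Cardinal.lift.{u + 1} (Cardinal.mk X) < Cardinal.mk (Superstructure S) := by
  have h := Cardinal.mk_le_of_injective
    ((toSet_injective P).comp (ULift.down_injective : Function.Injective (ULift.down.{u + 1})))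
  refine lt_of_lt_of_le ?_ h
  rw [Cardinal.mk_uLift, Cardinal.lift_lt, Cardinal.mk_set]
  exact Cardinal.cantor _

/-- A nonempty set directed downwards has a nonstandard element below all its standard ones. -/
theorem IsPolysaturated.exists_le [Preorder X] (hN : N.IsPolysaturated) (P : Copy S X) {W : Set X}
    (hne : W.Nonempty) (hdir : DirectedOn (· ≥ ·) W) :
    ∃ κ, ∀ w ∈ W, κ ∈ N.star P (W ∩ Set.Iic w) := by
  -- Asking for a standard witness in `W` lets directedness drive the induction.
  have hfin : ∀ G : Set (Superstructure S'), G.Finite →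
      G ⊆ Set.range (fun w : W => N.star P (W ∩ Set.Iic w.1)) →
      ∃ v ∈ W, ∀ b ∈ G, N.coe P v ∈ b := by
    intro G hG
    induction G, hG using Set.Finite.induction_on with
    | empty =>
      intro _
      obtain ⟨w, hw⟩ := hne
      exact ⟨w, hw, by simp⟩
    | @insert b G _ _ ih =>
      intro h
      obtain ⟨v, hv, hvG⟩ := ih ((Set.subset_insert _ _).trans h)
      obtain ⟨w, rfl⟩ := h (Set.mem_insert _ _)
      obtain ⟨v', hv', hle, hle'⟩ := hdir v hv w w.2
      refine ⟨v', hv', ?_⟩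
      rintro c (rfl | hc)
      · exact coe_mem_star.2 ⟨hv', hle'⟩
      · have hcv := hvG c hc
        obtain ⟨w', rfl⟩ := h (Set.mem_insert_of_mem _ hc)
        exact coe_mem_star.2 ⟨hv', hle.trans (coe_mem_star.1 hcv).2⟩
  obtain ⟨κ, hκ⟩ := hN (Set.range fun w : W => N.star P (W ∩ Set.Iic w.1)) (by
      rintro _ ⟨w, rfl⟩
      have hw : (P.equiv w.1).1 ∈ toSet P (W ∩ Set.Iic w.1) := equiv_mem_toSet.2 ⟨w.2, le_rfl⟩
      -- Internality: `*s` belongs to `*{s}`.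
      refine ⟨?_, unordered (toSet P (W ∩ Set.Iic w.1)) (toSet P (W ∩ Set.Iic w.1)), ?_⟩
      · exact not_mem_base_of_mem (N.map_mem_map.2 hw)
      · exact N.map_mem_map.2 (mem_unordered.2 (Or.inl rfl)))
    (by
      have h1 := Cardinal.mk_range_le_lift (f := fun w : W => N.star P (W ∩ Set.Iic w.1))
      rw [Cardinal.lift_id'.{u, u + 1}] at h1
      refine (h1.trans ?_).trans_lt (mk_lt_mk_superstructure P)
      exact Cardinal.lift_le.2 (Cardinal.mk_set_le W))
    (fun G hG hGf => by
      obtain ⟨v, -, hv⟩ := hfin G hGf hG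
      exact ⟨_, hv⟩)
  exact ⟨κ, fun w hw => hκ _ ⟨⟨w, hw⟩, rfl⟩⟩

end NonstandardExtension

/-! ### Order null nets -/

section OrderNull

variable {X : Type u} [AddCommGroup X] [Lattice X] [IsOrderedAddMonoid X]

/-- A set directed downwards with infimum `0`, as a net, is order convergent to `0`. -/
theorem orderNull_subtype {D : Set X} (hne : D.Nonempty) (hdir : DirectedOn (· ≥ ·) D)
    (hD : IsGLB D 0) : OrderNull fun d : Dᵒᵈ => (OrderDual.ofDual d).1 := by
  have hdown : DecreasesToZero fun d : Dᵒᵈ => (OrderDual.ofDual d).1 := by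
    refine ⟨fun a b h => h, ?_⟩
    have : Set.range (fun d : Dᵒᵈ => (OrderDual.ofDual d).1) = D := Subtype.range_coe
    rwa [this]
  have hdir' : IsDirectedOrder Dᵒᵈ := ⟨fun a b => by
    obtain ⟨c, hc, h1, h2⟩ := hdir a.1 a.2 b.1 b.2
    exact ⟨OrderDual.toDual ⟨c, hc⟩, h1, h2⟩⟩
  have hne' : Nonempty Dᵒᵈ := hne.to_subtype
  refine ⟨Dᵒᵈ, Dᵒᵈ, inferInstance, inferInstance, _, _, hdir', hne', hdir', hne', hdown, hdown,
    fun b c => ⟨c, fun a ha => ⟨?_, hdown.1 ha⟩⟩⟩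
  exact (neg_nonpos.2 (hD.1 b.2)).trans (hD.1 a.2)

theorem IsGLB.add_zero_range {B C : Type*} {y : B → X} {z : C → X}
    (hy : IsGLB (Set.range y) 0) (hz : IsGLB (Set.range z) 0) :
    IsGLB (Set.range fun i : B × C => y i.1 + z i.2) 0 := by
  constructor
  · rintro _ ⟨i, rfl⟩
    exact add_nonneg (hy.1 ⟨_, rfl⟩) (hz.1 ⟨_, rfl⟩)
  -- For fixed `b`, `l - y b` is a lower bound of the range of `z`; then `b` varies.
  · intro l hl
    refine hy.2 ?_
    rintro _ ⟨b, rfl⟩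
    have : l - y b ≤ 0 := hz.2 (by
      rintro _ ⟨c, rfl⟩
      exact sub_le_iff_le_add'.2 (hl ⟨(b, c), rfl⟩))
    exact sub_nonpos.1 this

end OrderNull

/-! ### The two implications -/

section LatticeNorm

open NonstandardExtension

variable {S S' : BaseSet.{u}} {N : NonstandardExtension S S'} {X E : Type u}
  [AddCommGroup X] [Lattice X] [IsOrderedAddMonoid X] [Module ℝ X]
  [AddCommGroup E] [Lattice E] [Module ℝ E]
  {p : X → E}

theorem IsLatticeNorm.le_of_mem_Icc (hp : IsLatticeNorm p) {x y : X} (h : x ∈ Set.Icc (-y) y) :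
    p x ≤ p y :=
  hp.mono x y ((abs_le'.2 ⟨h.2, neg_le.1 h.1⟩).trans (le_abs_self y))

variable [IsOrderedAddMonoid E]

theorem OpContinuous.eta_subset (hp : IsLatticeNorm p) (h : OpContinuous p)
    (P : Copy S X) (Q : Copy S E) : N.eta P ⊆ N.infinitesimals P Q p := by
  intro κ hκ
  obtain ⟨hκP, hglb⟩ := mem_eta_iff.1 hκ
  obtain ⟨ξ, hξQ, hκξ⟩ := exists_starRel (N := N) (Q := Q) (r := fun x e => p x = e)
    (fun x => ⟨p x, rfl⟩) hκP
  refine ⟨hκP, ξ, hκξ, mem_eta_iff.2 ⟨hξQ, fun e he => nonneg_of_mem_bounds he, fun e he => ?_⟩⟩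
  have hne := bounds_nonempty hκ
  have hdir : DirectedOn (· ≥ ·) (N.bounds P κ) := fun y hy z hz =>
    ⟨_, inf_mem_bounds hy hz, inf_le_left, inf_le_right⟩
  have hpb : ∀ y ∈ N.bounds P κ, p y ∈ N.bounds Q ξ := fun y hy => by
    refine mem_star_of_starRel ?_ hy hξQ hκξ
    rintro x hx _ rfl
    exact ⟨(neg_nonpos.2 (hp.nonneg y)).trans (hp.nonneg x), hp.le_of_mem_Icc hx⟩
  have hdir' : IsDirectedOrder (N.bounds P κ)ᵒᵈ := ⟨fun a b => by
    obtain ⟨c, hc, h1, h2⟩ := hdir a.1 a.2 b.1 b.2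
    exact ⟨OrderDual.toDual ⟨c, hc⟩, h1, h2⟩⟩
  have hne' : Nonempty (N.bounds P κ)ᵒᵈ := hne.to_subtype
  obtain ⟨B, C, _, _, y, z, -, ⟨b⟩, -, -, -, hz, hyz⟩ :=
    h _ _ (orderNull_subtype hne hdir hglb)
  -- It suffices that `e` lies below every `z c`. A single term of the net beyond the threshold
  -- gives `e ≤ p a ≤ z c`.
  refine hz.2.2 ?_
  rintro _ ⟨c, rfl⟩
  obtain ⟨a, ha⟩ := hyz b c
  have h2 := (ha a le_rfl).2
  simp only [sub_zero] at h2
  exact (he (hpb _ a.2)).trans h2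

theorem opContinuous_of_eta_subset (hN : N.IsPolysaturated) (hp : IsLatticeNorm p)
    {P : Copy S X} {Q : Copy S E} (h : N.eta P ⊆ N.infinitesimals P Q p) : OpContinuous p := by
  intro A _ _ _ x ⟨B, C, _, _, y, z, hB, hB', hC, hC', hy, hz, hx⟩
  have hw := IsGLB.add_zero_range hy.2 hz.2
  have hanti : Antitone fun i : B × C => y i.1 + z i.2 := fun i j hij =>
    add_le_add (hy.1 hij.1) (hz.1 hij.2)
  have hnn : ∀ i : B × C, 0 ≤ y i.1 + z i.2 := fun i => hw.1 ⟨i, rfl⟩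
  have hpm : ∀ {v w : X}, 0 ≤ v → v ≤ w → p v ≤ p w := fun {v w} hv hvw =>
    hp.le_of_mem_Icc ⟨(neg_nonpos.2 (hv.trans hvw)).trans hv, hvw⟩
  have hdir : DirectedOn (· ≥ ·) (Set.range fun i : B × C => y i.1 + z i.2) := by
    rintro _ ⟨i, rfl⟩ _ ⟨j, rfl⟩
    obtain ⟨b, hb1, hb2⟩ := directed_of (· ≤ ·) i.1 j.1
    obtain ⟨c, hc1, hc2⟩ := directed_of (· ≤ ·) i.2 j.2
    exact ⟨_, ⟨(b, c), rfl⟩, hanti (show i ≤ (b, c) from ⟨hb1, hc1⟩),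
      hanti (show j ≤ (b, c) from ⟨hb2, hc2⟩)⟩
  obtain ⟨κ, hκ⟩ := hN.exists_le P (Set.range_nonempty _) hdir
  have hbounds : (Set.range fun i : B × C => y i.1 + z i.2) ⊆ N.bounds P κ := by
    intro w hwW
    refine star_mono ?_ (hκ w hwW)
    rintro v ⟨hvW, hvw⟩
    exact ⟨(neg_nonpos.2 (hw.1 hwW)).trans (hw.1 hvW), hvw⟩
  have hκη : κ ∈ N.eta P := mem_eta_iff.2
    ⟨mem_starSet_of_mem_star (hκ _ ⟨Classical.arbitrary _, rfl⟩),
      fun v hv => nonneg_of_mem_bounds hv, fun l hl => hw.2 fun w hwW => hl (hbounds hwW)⟩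
  obtain ⟨-, ξ, hκξ, hξ⟩ := h hκη
  obtain ⟨hξQ, hξglb⟩ := mem_eta_iff.1 hξ
  have hpw : DecreasesToZero fun i : B × C => p (y i.1 + z i.2) := by
    refine ⟨fun i j hij => hpm (hnn j) (hanti hij), ?_, fun e he => hξglb.2 fun d hd => ?_⟩
    · rintro _ ⟨i, rfl⟩
      exact hp.nonneg _
    -- Here `κ ∈ *W` is needed, not just `κ` below `W`: `e ≤ p` on `W` transfers to `κ`.
    · have h1 : ξ ∈ N.star Q (Set.Ici e) := by
        refine mem_star_of_starRel ?_ (hκ _ ⟨Classical.arbitrary _, rfl⟩) hξQ hκξ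
        rintro _ ⟨⟨i, rfl⟩, -⟩ _ rfl
        exact he ⟨i, rfl⟩
      -- As `ξ` lies in both extensions, `[e, ∞)` and `[-d, d]` share a standard point, whence `e ≤
      -- d`.
      obtain ⟨e', he', hd'⟩ := nonempty_of_mem_star
        (star_inter_subset (fun _ h => h) h1 hd)
      exact le_trans he' hd'.2
  have hBC : IsDirectedOrder (B × C) := ⟨fun i j => by
    obtain ⟨b, hb1, hb2⟩ := directed_of (· ≤ ·) i.1 j.1
    obtain ⟨c, hc1, hc2⟩ := directed_of (· ≤ ·) i.2 j.2
    exact ⟨(b, c), ⟨hb1, hc1⟩, ⟨hb2, hc2⟩⟩⟩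
  refine ⟨B × C, B × C, inferInstance, inferInstance, _, _, hBC, inferInstance, hBC, inferInstance,
    hpw, hpw, fun i j => ?_⟩
  -- Only the upper index `j` matters, since `p` is nonnegative. Past `a₀`, both `x a` and its
  -- negative lie below `y j.1 + z j.2`.
  obtain ⟨a₀, ha₀⟩ := hx j.1 j.2
  refine ⟨a₀, fun a ha => ⟨(neg_nonpos.2 (hp.nonneg _)).trans (hp.nonneg _), ?_⟩⟩
  obtain ⟨h1, h2⟩ := ha₀ a ha
  have hy0 : 0 ≤ y j.1 := hy.2.1 ⟨_, rfl⟩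
  have hz0 : 0 ≤ z j.2 := hz.2.1 ⟨_, rfl⟩
  simp only [sub_zero]
  exact hp.le_of_mem_Icc ⟨(neg_le_neg (le_add_of_nonneg_right hz0)).trans h1,
    h2.trans (le_add_of_nonneg_left hy0)⟩

end LatticeNorm

end LatticeNormed

theorem theorem7 {S S' : LatticeNormed.BaseSet.{u}}
    (N : LatticeNormed.NonstandardExtension S S') (hN : N.IsPolysaturated)
    {X E : Type u}
    [AddCommGroup X] [Lattice X] [IsOrderedAddMonoid X] [Module ℝ X] [IsOrderedModule ℝ X]
    [AddCommGroup E] [Lattice E] [IsOrderedAddMonoid E] [Module ℝ E] [IsOrderedModule ℝ E]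
    (hE : LatticeNormed.DedekindComplete E)
    (p : X → E) (hp : LatticeNormed.IsLatticeNorm p)
    (P : LatticeNormed.Copy S X) (Q : LatticeNormed.Copy S E) :
    LatticeNormed.OpContinuous p ↔ N.eta P ⊆ N.infinitesimals P Q p := by
  exact ⟨fun h => h.eta_subset hp P Q, LatticeNormed.opContinuous_of_eta_subset hN hp⟩
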